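/- Let $K$ be a field with a valuation $\nu : K \to \Gamma\cup\{\infty\}$, where $\Gamma$ is a totally ordered abelian group (possibly trivial), let $\mathcal{O}=\{a\in K : \nu(a)\ge 0\}$ be its valuation ring, and let $d\ge 1$ be an integer. Call a set $X\subseteq K^d$ convex if $\alpha_1x_1+\dots+\alpha_nx_n\in X$ whenever $n\ge 1$, $x_1,\dots,x_n\in X$, and $\alpha_1,\dots,\alpha_n\in\mathcal{O}$ satisfy $\alpha_1+\dots+\alpha_n=1$. Then the family $\operatorname{Conv}_{K^d}$ of all convex subsets of $K^d$ has breadth exactly $d$: for any finitely many convex sets in $K^d$ with nonempty intersection, that intersection is equal to the intersection of at most $d$ of these sets, and $d$ is the least positive integer with this property. -/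

import Mathlib

/-- Convexity in `K^d` over a field `K` with valuation `v`: closure under all combinations
`α₁ x₁ + ... + αₙ xₙ`, `n ≥ 1`, whose coefficients lie in the valuation ring of `v` and sum to `1`.
Mathlib's valuations are written multiplicatively, so the valuation ring is `{a | v a ≤ 1}`. -/
def ValConvex {K Γ₀ : Type*} [Field K] [LinearOrderedCommGroupWithZero Γ₀]
    (v : Valuation K Γ₀) {d : ℕ} (X : Set (Fin d → K)) : Prop :=
  ∀ n : ℕ, 1 ≤ n → ∀ (x : Fin n → Fin d → K) (α : Fin n → K),
    (∀ i, x i ∈ X) → (∀ i, α i ∈ v.valuationSubring) → ∑ i, α i = 1 → ∑ i, α i • x i ∈ X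

/-- The family of convex subsets of `K^d`. -/
def convFamily {K Γ₀ : Type*} [Field K] [LinearOrderedCommGroupWithZero Γ₀]
    (v : Valuation K Γ₀) (d : ℕ) : Set (Set (Fin d → K)) :=
  {X | ValConvex v X}

/-- Any nonempty intersection of finitely many sets in `F` is the intersection of at most `m`
of them. -/
def BreadthAtMost {X : Type*} (F : Set (Set X)) (m : ℕ) : Prop :=
  ∀ G : Finset (Set X), (∀ C ∈ G, C ∈ F) → (⋂ C ∈ G, C).Nonempty →
    ∃ H ⊆ G, H.card ≤ m ∧ (⋂ C ∈ H, C) = ⋂ C ∈ G, C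

/-- The family `F` has breadth `d`: `d` is the least positive integer with `BreadthAtMost F d`. -/
def HasBreadth {X : Type*} (F : Set (Set X)) (d : ℕ) : Prop :=
  IsLeast {m : ℕ | 1 ≤ m ∧ BreadthAtMost F m} d

/-! Let an irredundant family have a common point p, and for each member C pick x_C outside C but in
all other members. With more than d members the vectors x_C - p are dependent, so one of them is a
combination of the others with coefficients in the valuation ring. Those others lie in C - p, a
module over that ring, which forces x_C ∈ C. Coordinate hyperplanes show that d is optimal. -/

namespace ValConvex

variable {K Γ₀ : Type*} [Field K] [LinearOrderedCommGroupWithZero Γ₀]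
  {v : Valuation K Γ₀} {d : ℕ} {X : Set (Fin d → K)}

/-- Convexity for combinations indexed by an arbitrary finite set. -/
lemma sum_mem (hX : ValConvex v X) {ι : Type*} (s : Finset ι) (x : ι → Fin d → K) (α : ι → K)
    (hx : ∀ i ∈ s, x i ∈ X) (hα : ∀ i ∈ s, α i ∈ v.valuationSubring)
    (hsum : ∑ i ∈ s, α i = 1) : ∑ i ∈ s, α i • x i ∈ X := by
  have hs : s.Nonempty := by
    rw [Finset.nonempty_iff_ne_empty]
    rintro rfl
    simp at hsum
  have key {M : Type _} [AddCommMonoid M] (f : ι → M) :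
      ∑ k, f (s.equivFin.symm k) = ∑ i ∈ s, f i := by
    rw [← Finset.sum_coe_sort s f]
    exact Equiv.sum_comp s.equivFin.symm fun i : s ↦ f i
  have := hX s.card hs.card_pos (fun k ↦ x (s.equivFin.symm k)) (fun k ↦ α (s.equivFin.symm k))
    (fun k ↦ hx _ (s.equivFin.symm k).2) (fun k ↦ hα _ (s.equivFin.symm k).2)
    ((key α).trans hsum)
  rwa [key fun i ↦ α i • x i] at this

/-- A convex set containing `p` is the translate by `p` of a set closed under linear combinations
with coefficients in the valuation ring. -/
lemma add_sum_mem (hX : ValConvex v X) {p : Fin d → K} (hp : p ∈ X) {ι : Type*} (s : Finset ι)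
    (x : ι → Fin d → K) (α : ι → K) (hx : ∀ i ∈ s, x i ∈ X)
    (hα : ∀ i ∈ s, α i ∈ v.valuationSubring) : p + ∑ i ∈ s, α i • (x i - p) ∈ X := by
  -- The base point `p`, at index `none`, absorbs the leftover weight; no positivity is needed, as a
  -- ring is closed under subtraction.
  have := hX.sum_mem (Finset.insertNone s) (fun o ↦ o.elim p x)
    (fun o ↦ o.elim (1 - ∑ i ∈ s, α i) α) ?_ ?_ ?_
  · rw [Finset.sum_insertNone] at this
    convert this using 1
    simp only [Option.elim, smul_sub, Finset.sum_sub_distrib, sub_smul, one_smul, Finset.sum_smul]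
    abel
  · rintro (_ | i) hi
    · exact hp
    · exact hx i (Finset.some_mem_insertNone.1 hi)
  · rintro (_ | i) hi
    · exact sub_mem (one_mem _) (_root_.sum_mem hα)
    · exact hα i (Finset.some_mem_insertNone.1 hi)
  · rw [Finset.sum_insertNone]
    simp

lemma coordinate_hyperplane (v : Valuation K Γ₀) (i : Fin d) :
    ValConvex v {x : Fin d → K | x i = 0} := by
  intro n _ x α hx _ _
  simp only [Set.mem_ofPred_eq] at hx
  simp [Finset.sum_apply, hx]

end ValConvex

/-- In a linearly dependent family over a valued field, some vector is a combination of the others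
with coefficients in the valuation ring. -/
lemma exists_eq_sum_valuationSubring_smul {K Γ₀ E ι : Type*} [Field K]
    [LinearOrderedCommGroupWithZero Γ₀] (v : Valuation K Γ₀) [AddCommGroup E] [Module K E]
    [Fintype ι] [DecidableEq ι] (y : ι → E) (hy : ¬ LinearIndependent K y) :
    ∃ (i : ι) (β : ι → K), (∀ j, β j ∈ v.valuationSubring) ∧
      y i = ∑ j ∈ Finset.univ.erase i, β j • y j := by
  obtain ⟨c, hc, k, hk⟩ := Fintype.not_linearIndependent_iff.1 hy
  -- Dividing the relation by a coefficient of largest `v` makes every ratio integral.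
  obtain ⟨i, -, hi⟩ := Finset.exists_max_image Finset.univ (fun j ↦ v (c j)) ⟨k, Finset.mem_univ k⟩
  have hvi : 0 < v (c i) := ((v.pos_iff).2 hk).trans_le (hi k (Finset.mem_univ k))
  have hci : c i ≠ 0 := v.pos_iff.1 hvi
  refine ⟨i, fun j ↦ -((c i)⁻¹ * c j), fun j ↦ ?_, ?_⟩
  · rw [Valuation.mem_valuationSubring_iff, Valuation.map_neg, map_mul, map_inv₀]
    exact inv_mul_le_one_of_le₀ (hi j (Finset.mem_univ j)) hvi.le
  · rw [← Finset.add_sum_erase _ _ (Finset.mem_univ i)] at hc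
    simp only [neg_smul, mul_smul, Finset.sum_neg_distrib, ← Finset.smul_sum]
    rw [← smul_neg, ← eq_neg_of_add_eq_zero_left hc, inv_smul_smul₀ hci]

/-- If deleting any set of `G` enlarges the intersection, then `G` has at most `m` members: this
suffices for breadth at most `m`. -/
lemma BreadthAtMost.of_irredundant {X : Type*} {F : Set (Set X)} {m : ℕ}
    (h : ∀ G : Finset (Set X), (∀ C ∈ G, C ∈ F) → (⋂ C ∈ G, C).Nonempty →
      (∀ C ∈ G, ∃ x ∉ C, ∀ D ∈ G, D ≠ C → x ∈ D) → G.card ≤ m) : BreadthAtMost F m := by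
  classical
  intro G
  induction G using Finset.strongInduction with
  | H G ih =>
    intro hG hne
    by_cases hirr : ∀ C ∈ G, ∃ x ∉ C, ∀ D ∈ G, D ≠ C → x ∈ D
    · exact ⟨G, Finset.Subset.refl G, h G hG hne hirr, rfl⟩
    · push Not at hirr
      obtain ⟨C, hC, hCG⟩ := hirr
      have hE : (⋂ D ∈ G.erase C, D) = ⋂ D ∈ G, D := by
        ext x
        simp only [Set.mem_iInter, Finset.mem_erase]
        refine ⟨fun hx D hD ↦ ?_, fun hx D hD ↦ hx D hD.2⟩
        by_contra hxD
        by_cases hxC : x ∈ C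
        · exact hxD (hx D ⟨fun hDC ↦ hxD (hDC ▸ hxC), hD⟩)
        · obtain ⟨D', hD', hne', hx'⟩ := hCG x hxC
          exact hx' (hx D' ⟨hne', hD'⟩)
      obtain ⟨H, hH, hcard, hHG⟩ := ih (G.erase C) (Finset.erase_ssubset hC)
        (fun D hD ↦ hG D (Finset.mem_of_mem_erase hD)) (hE ▸ hne)
      exact ⟨H, hH.trans (Finset.erase_subset C G), hcard, hHG.trans hE⟩

lemma breadthAtMost_convFamily {K Γ₀ : Type*} [Field K] [LinearOrderedCommGroupWithZero Γ₀]
    (v : Valuation K Γ₀) (d : ℕ) : BreadthAtMost (convFamily v d) d := by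
  classical
  refine BreadthAtMost.of_irredundant fun G hG ⟨p, hp⟩ hirr ↦ ?_
  simp only [Set.mem_iInter] at hp
  choose! x hxC hxD using hirr
  by_contra! hcard
  have hdep : ¬ LinearIndependent K fun C : G ↦ x C - p := fun hli ↦ by
    have := hli.fintype_card_le_finrank
    simp only [Fintype.card_coe, Module.finrank_fin_fun] at this
    omega
  obtain ⟨C, β, hβ, hC⟩ := exists_eq_sum_valuationSubring_smul v _ hdep
  refine hxC C C.2 ?_
  have := (show ValConvex v (C : Set (Fin d → K)) from hG C C.2).add_sum_mem (hp C C.2)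
    (Finset.univ.erase C) (fun D ↦ x D) β
    (fun D hD ↦ hxD D D.2 C C.2 fun h ↦ Finset.ne_of_mem_erase hD (Subtype.ext h.symm))
    (fun D _ ↦ hβ D)
  rwa [← hC, add_sub_cancel] at this

lemma le_of_breadthAtMost_convFamily {K Γ₀ : Type*} [Field K] [LinearOrderedCommGroupWithZero Γ₀]
    (v : Valuation K Γ₀) {d m : ℕ} (h : BreadthAtMost (convFamily v d) m) : d ≤ m := by
  classical
  let P : Fin d → Set (Fin d → K) := fun i ↦ {x | x i = 0}
  obtain ⟨H, hHG, hcard, hH⟩ := h (Finset.univ.image P)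
    (by
      intro C hC
      obtain ⟨i, -, rfl⟩ := Finset.mem_image.1 hC
      exact ValConvex.coordinate_hyperplane v i)
    ⟨0, by simp [P]⟩
  have hP : ∀ i, P i ∈ H := by
    intro i
    by_contra hi
    -- The `i`-th basis vector lies in every coordinate hyperplane except `P i`, so `P i` cannot be
    -- omitted.
    have hmem : (Pi.single i 1 : Fin d → K) ∈ ⋂ C ∈ H, C := by
      simp only [Set.mem_iInter]
      intro C hC
      obtain ⟨j, -, rfl⟩ := Finset.mem_image.1 (hHG hC)
      have hji : j ≠ i := by
        rintro rfl
        exact hi hC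
      simp [P, hji]
    rw [hH] at hmem
    simp only [Set.mem_iInter] at hmem
    simpa [P] using hmem (P i) (Finset.mem_image_of_mem P (Finset.mem_univ i))
  have hinj : Function.Injective P := by
    intro i j hij
    by_contra hne
    have hmem : (Pi.single j 1 : Fin d → K) ∈ P i := by simp [P, hne]
    rw [hij] at hmem
    simp [P] at hmem
  calc d = (Finset.univ.image P).card := by
        rw [Finset.card_image_of_injective _ hinj, Finset.card_univ, Fintype.card_fin]
    _ ≤ H.card := Finset.card_le_card fun C hC ↦ by
        obtain ⟨i, -, rfl⟩ := Finset.mem_image.1 hC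
        exact hP i
    _ ≤ m := hcard

theorem theorem4p2 {K Γ₀ : Type*} [Field K] [LinearOrderedCommGroupWithZero Γ₀]
    (v : Valuation K Γ₀) (d : ℕ) (hd : 1 ≤ d) :
    HasBreadth (convFamily v d) d :=
  ⟨⟨hd, breadthAtMost_convFamily v d⟩, fun _ hm ↦ le_of_breadthAtMost_convFamily v hm.2⟩
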